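/- Let $H$ and $H_0$ be complex Hilbert spaces. A linear system $(-A,B,C)$ with state space $H$ and input and output space $H_0$ consists of the generator $-A$ of a $C_0$ semigroup $(e^{-tA})_{t\ge 0}$ on $H$ with $\sup_{t\ge0}\|e^{-tA}\|<\infty$, and of bounded operators $B:H_0\to H$ and $C:H\to H_0$. It is $(2,2)$-admissible if $\Theta_0 f=\int_0^\infty e^{-sA^\dagger}C^\dagger f(s)\,ds$ and $\Xi_0 f=\int_0^\infty e^{-sA}Bf(s)\,ds$ (defined on $L^1\cap L^2$ and extended by continuity) are bounded and Hilbert--Schmidt operators $L^2((0,\infty);H_0)\to H$. A solution of the Lyapunov equation is a holomorphic function $R:\mathbb{C}\to B(H)$ such that $$-\frac{dR_x}{dx}=AR_x+R_xA\quad(x\in\mathbb{C}),\qquad AR_0+R_0A=BC .$$ **Theorem 1.1.** (i) Let $(-A,B,C)$ be a $(2,2)$-admissible linear system with $A$ bounded. Then there is a solution $R$ of the Lyapunov equation such that $R_x$ is trace class for all $x\in\mathbb{C}$, $R_x=\int_x^\infty e^{-tA}BCe^{-tA}\,dt$ for all real $x\ge 0$ (as a weakly convergent integral), and $\tau(x)=\det(I+R_x)$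 is an entire function. (ii) Let $(-A,B,C)$ be a linear system with $H_0=H$ such that $(e^{-xA})_{x\in\mathbb{R}}$ is a uniformly continuous (that is, norm-continuous) group with period $\pi$, and let $E$ be a trace class operator on $H$ with $AE+EA=BC$. Then there is a solution $R$ of the Lyapunov equation with $R_0=E$ such that $R_x$ is trace class for all $x\in\mathbb{C}$ and $\tau(x)=\det(I+R_x)$ is entire with $\tau(x+\pi)=\tau(x)$ for all $x\in\mathbb{C}$. (iii) In case (i) the function $\tau$ is not identically zero, and $u=-2(\log\tau)''=-2(\tau'/\tau)'$ is meromorphic on $\mathbb{C}$. In case (ii), $u=-2(\log\tau)''$ is meromorphic on $\mathbb{C}$ whenever $\tau$ is not identically zero. -/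

import Mathlib

open MeasureTheory Filter Topology
open scoped NNReal

noncomputable section

universe u v

/-! ### Operator ideals on complex Hilbert spaces and the Fredholm determinant -/

/-- A bounded operator between Hilbert spaces is Hilbert--Schmidt if the sum of `‖T e‖²` over an
orthonormal basis of its source is finite. -/
def IsHilbertSchmidt {E : Type u} {F : Type v}
    [NormedAddCommGroup E] [InnerProductSpace ℂ E] [NormedAddCommGroup F] [InnerProductSpace ℂ F]
    (T : E →L[ℂ] F) : Prop :=
  ∃ (w : Set E) (b : HilbertBasis w ℂ E), Summable fun i => ‖T (b i)‖ ^ 2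

/-- A bounded operator on a Hilbert space is trace class (nuclear) if it is a sum
`∑ ⟪yₙ, ·⟫ xₙ` of operators of rank at most one with `∑ ‖xₙ‖ ‖yₙ‖ < ∞`. -/
def IsTraceClass {H : Type u} [NormedAddCommGroup H] [InnerProductSpace ℂ H]
    (T : H →L[ℂ] H) : Prop :=
  ∃ x y : ℕ → H, (Summable fun n => ‖x n‖ * ‖y n‖) ∧
    ∀ ξ : H, HasSum (fun n => inner ℂ (y n) ξ • x n) (T ξ)

open Classical in
/-- `HasFredholmDet T d` says that `det (I + T) = d`: in every orthonormal basis `(bᵢ)` of `H`, the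
determinants of the finite sections `(δᵢⱼ + ⟪bᵢ, T bⱼ⟫)_{i, j ∈ s}` converge to `d` along the net of
finite sets `s` of indices. -/
def HasFredholmDet {H : Type u} [NormedAddCommGroup H] [InnerProductSpace ℂ H]
    (T : H →L[ℂ] H) (d : ℂ) : Prop :=
  ∀ (ι : Type u) (b : HilbertBasis ι ℂ H),
    Tendsto
      (fun s : Finset ι =>
        Matrix.det (1 + Matrix.of fun i j : s => inner ℂ (b (i : ι)) (T (b (j : ι)))))
      atTop (𝓝 d)

/-- A Fredholm determinant has at most one value. -/
theorem HasFredholmDet.unique {H : Type u} [NormedAddCommGroup H] [InnerProductSpace ℂ H]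
    [CompleteSpace H] {T : H →L[ℂ] H} {d e : ℂ}
    (hd : HasFredholmDet T d) (he : HasFredholmDet T e) : d = e := by
  obtain ⟨w, b, -⟩ := exists_hilbertBasis ℂ H
  exact tendsto_nhds_unique (hd w b) (he w b)

/-! ### Linear systems -/

/-- A linear system `(-A, B, C)` with state space `H` and input and output space `H₀`: `-A` is the
generator of a bounded `C₀` semigroup `S t = e^{-tA}` (`t ≥ 0`) on `H`, and `B`, `C` are bounded.
The values `S t` for `t < 0` carry no information. -/
structure LinearSystem (H : Type u) (H₀ : Type v)
    [NormedAddCommGroup H] [InnerProductSpace ℂ H]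
    [NormedAddCommGroup H₀] [InnerProductSpace ℂ H₀] where
  /-- the operator `A`, possibly unbounded, with its domain -/
  A : H →ₗ.[ℂ] H
  /-- the input operator -/
  B : H₀ →L[ℂ] H
  /-- the output operator -/
  C : H →L[ℂ] H₀
  /-- the semigroup `t ↦ e^{-tA}`, `t ≥ 0` -/
  S : ℝ → H →L[ℂ] H
  S_zero : S 0 = 1
  S_add : ∀ s t : ℝ, 0 ≤ s → 0 ≤ t → S (s + t) = S s * S t
  S_continuous : ∀ ξ : H, ContinuousOn (fun t => S t ξ) (Set.Ici 0)
  S_bounded : ∃ M : ℝ, ∀ t : ℝ, 0 ≤ t → ‖S t‖ ≤ M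
  /-- `ξ ∈ D(A)` and `A ξ = η` if and only if `(S t ξ - ξ) / t → -η` as `t → 0+` -/
  generator : ∀ ξ η : H,
    (ξ, η) ∈ A.graph ↔ HasDerivWithinAt (fun t => S t ξ) (-η) (Set.Ici 0) 0

/-- The space `L²((0, ∞); H₀)`. -/
abbrev HalfLineL2 (H₀ : Type v) [NormedAddCommGroup H₀] : Type v :=
  Lp H₀ 2 (volume.restrict (Set.Ioi (0 : ℝ)))

/-- `A R + R A = Q` for bounded `R`, `Q` and possibly unbounded `A`: the operator `R` maps `D(A)`
into `D(A)`, and the identity holds at every vector of `D(A)`. -/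
def AnticommutatorEq {H : Type u} [NormedAddCommGroup H] [InnerProductSpace ℂ H]
    (A : H →ₗ.[ℂ] H) (R Q : H →L[ℂ] H) : Prop :=
  ∀ ξ : A.domain, ∃ h : R ξ ∈ A.domain, A ⟨R ξ, h⟩ + R (A ξ) = Q ξ

namespace LinearSystem

section

variable {H : Type u} {H₀ : Type v}
  [NormedAddCommGroup H] [InnerProductSpace ℂ H] [CompleteSpace H]
  [NormedAddCommGroup H₀] [InnerProductSpace ℂ H₀] [CompleteSpace H₀]

/-- `Θ` is the bounded observability operator `Θ f = ∫₀^∞ e^{-sA†} C† f(s) ds`, given by the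
integral on the dense subspace `L¹ ∩ L²` and extended by continuity. -/
def IsObservabilityOperator (L : LinearSystem H H₀) (Θ : HalfLineL2 H₀ →L[ℂ] H) : Prop :=
  ∀ f : HalfLineL2 H₀, Integrable f (volume.restrict (Set.Ioi (0 : ℝ))) →
    Θ f = ∫ s in Set.Ioi (0 : ℝ),
      ContinuousLinearMap.adjoint (L.S s) (ContinuousLinearMap.adjoint L.C (f s))

/-- `Ξ` is the bounded controllability operator `Ξ f = ∫₀^∞ e^{-sA} B f(s) ds`, given by the
integral on the dense subspace `L¹ ∩ L²` and extended by continuity. -/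
def IsControllabilityOperator (L : LinearSystem H H₀) (Ξ : HalfLineL2 H₀ →L[ℂ] H) : Prop :=
  ∀ f : HalfLineL2 H₀, Integrable f (volume.restrict (Set.Ioi (0 : ℝ))) →
    Ξ f = ∫ s in Set.Ioi (0 : ℝ), L.S s (L.B (f s))

/-- `(-A, B, C)` is `(2,2)`-admissible: the observability and the controllability operators are
bounded and Hilbert--Schmidt. -/
def IsTwoTwoAdmissible (L : LinearSystem H H₀) : Prop :=
  (∃ Θ, L.IsObservabilityOperator Θ ∧ IsHilbertSchmidt Θ) ∧
    (∃ Ξ, L.IsControllabilityOperator Ξ ∧ IsHilbertSchmidt Ξ)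

/-- `A` is a bounded operator, defined on the whole of `H`. -/
def HasBoundedA (L : LinearSystem H H₀) : Prop :=
  L.A.domain = ⊤ ∧ ∃ c : ℝ, ∀ ξ : L.A.domain, ‖L.A ξ‖ ≤ c * ‖(ξ : H)‖

/-- The semigroup `e^{-tA}` extends to a group `(e^{-tA})_{t ∈ ℝ}` of bounded operators which is
continuous for the operator norm and periodic with period `p`. -/
def IsUniformlyContinuousPeriodicGroup (L : LinearSystem H H₀) (p : ℝ) : Prop :=
  ∃ U : ℝ → H →L[ℂ] H, (∀ t : ℝ, 0 ≤ t → U t = L.S t) ∧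
    (∀ s t : ℝ, U (s + t) = U s * U t) ∧ Continuous U ∧ Function.Periodic U p

/-- `R` solves the Lyapunov equation `-dR_z/dz = A R_z + R_z A`, here for all complex `z`, with the
initial condition `A R_0 + R_0 A = B C`. -/
def IsLyapunovSolution (L : LinearSystem H H₀) (R : ℂ → H →L[ℂ] H) : Prop :=
  Differentiable ℂ R ∧ (∀ z : ℂ, AnticommutatorEq L.A (R z) (-deriv R z)) ∧
    AnticommutatorEq L.A (R 0) (L.B ∘L L.C)

/-- `R_x = ∫_x^∞ e^{-tA} B C e^{-tA} dt` for real `x ≥ 0`, as a weakly convergent integral. -/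
def IsTailIntegral (L : LinearSystem H H₀) (R : ℂ → H →L[ℂ] H) : Prop :=
  ∀ x : ℝ, 0 ≤ x → ∀ ξ η : H,
    IntegrableOn (fun t => inner ℂ η (L.S t (L.B (L.C (L.S t ξ))))) (Set.Ioi x) ∧
      inner ℂ η (R x ξ) = ∫ t in Set.Ioi x, inner ℂ η (L.S t (L.B (L.C (L.S t ξ))))

end

end LinearSystem

/-! ### The potential -/

/-- The potential `u = -2 (log τ)''`, written as `-2 (τ' / τ)'` so that no branch of the logarithm
has to be chosen. It is meaningful where `τ ≠ 0`. -/
def potential (τ : ℂ → ℂ) (z : ℂ) : ℂ :=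
  -2 * deriv (logDeriv τ) z

/-- On an open set where `τ` has a holomorphic logarithm `l`, the potential is `-2 l''`. -/
theorem potential_eq_of_exp_eq {τ l : ℂ → ℂ} {V : Set ℂ} (hV : IsOpen V)
    (hl : DifferentiableOn ℂ l V) (h : ∀ z ∈ V, Complex.exp (l z) = τ z) {z : ℂ} (hz : z ∈ V) :
    potential τ z = -2 * deriv (deriv l) z := by
  have key : ∀ w ∈ V, logDeriv τ w = deriv l w := by
    intro w hw
    have e : τ =ᶠ[𝓝 w] fun y => Complex.exp (l y) :=
      Filter.eventually_of_mem (hV.mem_nhds hw) fun y hy => (h y hy).symm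
    have hd : HasDerivAt l (deriv l w) w :=
      ((hl w hw).differentiableAt (hV.mem_nhds hw)).hasDerivAt
    rw [logDeriv_apply, e.deriv_eq, hd.cexp.deriv, ← h w hw]
    field_simp [Complex.exp_ne_zero]
  have e2 : logDeriv τ =ᶠ[𝓝 z] deriv l :=
    Filter.eventually_of_mem (hV.mem_nhds hz) key
  rw [potential, e2.deriv_eq]

end

noncomputable section

universe u v

/-! ### Trace norm bounds for determinants of finite sections -/

section DeterminantBounds

variable {H : Type u} [NormedAddCommGroup H] [InnerProductSpace ℂ H]

/-! The solution is R_z = e^{-zA} R_0 e^{-zA}, entire because A is bounded; the product rule gives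
the differential equation. What remains is a trace class R_0 with A R_0 + R_0 A = BC. In (ii) it is
E, once norm continuity is seen to force a bounded generator (`exists_mem_graph_of_group`). In (i)
it is Ξ Θ†, nuclear as a product of Hilbert–Schmidt operators. Pairing the L² functions Θ†ξ and Ξ†η
exhibits it as the weak integral of e^{-tA} B C e^{-tA}, and integrating the derivative of that
integrand gives the equation (`lyapunov_of_operators`).

For the determinant, write R_0 = ∑ ⟪yₙ, ·⟫ xₙ. Truncating the series leads to N × N determinants
holomorphic in z. A Lipschitz bound in trace norm, uniform over all finite sections
(`TraceNormLE.norm_sectionDet_sub_le`), makes them converge locally uniformly to det (I + R_z), so τ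
is entire (`exists_entire_fredholmDet`) and u is meromorphic.

In (ii), e^{-πA} = 1 makes R and τ periodic. In (i), the xₙ lie in the range of Ξ, where e^{-tA}
decays weakly (`IsControllabilityOperator.tendsto_inner_zero`). The N × N determinants thus tend to
1 as t → ∞, while the approximation is uniform in t ≥ 0, so τ is not identically zero. -/

theorem Orthonormal.sum_norm_inner_mul_norm_inner_le {ι : Type*} {b : ι → H}
    (hb : Orthonormal ℂ b) (s : Finset ι) (y z : H) :
    ∑ i ∈ s, ‖inner ℂ y (b i)‖ * ‖inner ℂ (b i) z‖ ≤ ‖y‖ * ‖z‖ := by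
  have h := Finset.sum_mul_sq_le_sq_mul_sq s (fun i => ‖inner ℂ y (b i)‖)
    (fun i => ‖inner ℂ (b i) z‖)
  have hy := hb.sum_inner_products_le (s := s) y
  have hz := hb.sum_inner_products_le (s := s) z
  simp only [norm_inner_symm y] at h ⊢
  refine abs_le_of_sq_le_sq' ?_ (by positivity) |>.2
  rw [mul_pow]
  exact h.trans (mul_le_mul hy hz (Finset.sum_nonneg fun _ _ => by positivity) (by positivity))

/-- The trace norm of `T` is at most `c`, in the dual formulation: every finite diagonal sum of
`S T` is bounded by `‖S‖ c`. -/
def TraceNormLE (T : H →L[ℂ] H) (c : ℝ) : Prop :=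
  ∀ (S : H →L[ℂ] H) (ι : Type u) (b : ι → H), Orthonormal ℂ b → ∀ s : Finset ι,
    ‖∑ i ∈ s, inner ℂ (b i) (S (T (b i)))‖ ≤ ‖S‖ * c

theorem TraceNormLE.mono {T : H →L[ℂ] H} {c d : ℝ} (h : TraceNormLE T c) (hcd : c ≤ d) :
    TraceNormLE T d := fun S ι b hb s =>
  (h S ι b hb s).trans (mul_le_mul_of_nonneg_left hcd (norm_nonneg _))

theorem TraceNormLE.add_smul {T N : H →L[ℂ] H} {c d : ℝ} (hT : TraceNormLE T c)
    (hN : TraceNormLE N d) (t : ℂ) : TraceNormLE (T + t • N) (c + ‖t‖ * d) := by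
  intro S ι b hb s
  have e : ∑ i ∈ s, inner ℂ (b i) (S ((T + t • N) (b i)))
      = ∑ i ∈ s, inner ℂ (b i) (S (T (b i))) + t * ∑ i ∈ s, inner ℂ (b i) (S (N (b i))) := by
    rw [Finset.mul_sum, ← Finset.sum_add_distrib]
    refine Finset.sum_congr rfl fun i _ => ?_
    simp
  rw [e]
  refine (norm_add_le _ _).trans ?_
  rw [norm_mul]
  have h1 := hT S ι b hb s
  have h2 := mul_le_mul_of_nonneg_left (hN S ι b hb s) (norm_nonneg t)
  linarith

/-- By Bessel and Cauchy–Schwarz each rank-one term contributes at most ‖S‖ ‖xₙ‖ ‖yₙ‖. A majorant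
`a` replaces the norms so that the bound can be uniform in a parameter. -/
theorem TraceNormLE.of_hasSum {T : H →L[ℂ] H} {x y : ℕ → H} {a : ℕ → ℝ}
    (hT : ∀ ξ : H, HasSum (fun n => inner ℂ (y n) ξ • x n) (T ξ)) (ha : Summable a)
    (hxy : ∀ n, ‖x n‖ * ‖y n‖ ≤ a n) : TraceNormLE T (∑' n, a n) := by
  intro S ι b hb s
  have h : HasSum (fun n => ∑ i ∈ s, inner ℂ (y n) (b i) * inner ℂ (b i) (S (x n)))
      (∑ i ∈ s, inner ℂ (b i) (S (T (b i)))) := by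
    refine hasSum_sum fun i _ => ?_
    have := ((hT (b i)).mapL S).mapL (innerSL ℂ (b i))
    simpa [inner_smul_right] using this
  rw [← h.tsum_eq]
  refine tsum_of_norm_bounded (ha.hasSum.mul_left ‖S‖) fun n => ?_
  refine (norm_sum_le _ _).trans ?_
  simp only [norm_mul]
  refine (hb.sum_norm_inner_mul_norm_inner_le s _ _).trans ?_
  calc ‖y n‖ * ‖S (x n)‖ ≤ ‖y n‖ * (‖S‖ * ‖x n‖) := by gcongr; exact S.le_opNorm _
    _ = ‖S‖ * (‖x n‖ * ‖y n‖) := by ring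
    _ ≤ ‖S‖ * a n := by gcongr; exact hxy n

open scoped ComplexOrder in
-- The left side is the product of the eigenvalues l of (1 + M)†(1 + M). Since 0 ≤ l ≤ exp (l - 1),
-- it is at most the exponential of the trace of (1 + M)†(1 + M) - 1.
theorem Matrix.norm_det_sq_le_exp {n : Type*} [Fintype n] [DecidableEq n] (M : Matrix n n ℂ) :
    ‖(1 + M).det‖ ^ 2 ≤ Real.exp (2 * ‖M.trace‖ + ∑ j, ∑ i, ‖M i j‖ ^ 2) := by
  have hP := Matrix.posSemidef_conjTranspose_mul_self (1 + M)
  have hdet := hP.1.det_eq_prod_eigenvalues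
  have htr := hP.1.trace_eq_sum_eigenvalues
  set l := hP.1.eigenvalues
  have hl : ∀ i, 0 ≤ l i := hP.eigenvalues_nonneg
  have h1 : ‖(1 + M).det‖ ^ 2 = ∏ i, l i := by
    rw [Matrix.det_mul, Matrix.det_conjTranspose] at hdet
    have := congrArg norm hdet
    rw [norm_mul, norm_star, norm_prod, ← sq] at this
    rw [this]
    exact Finset.prod_congr rfl fun i _ => by simp [abs_of_nonneg (hl i)]
  have h2 : ∑ i, (l i - 1) = (2 * M.trace.re + ∑ j, ∑ i, ‖M i j‖ ^ 2) := by
    have e : ((1 + M).conjTranspose * (1 + M)).trace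
        = Fintype.card n + (star M.trace + M.trace) + ∑ j, ∑ i, ((‖M i j‖ ^ 2 : ℝ) : ℂ) := by
      have : (M.conjTranspose * M).trace = ∑ j, ∑ i, ((‖M i j‖ ^ 2 : ℝ) : ℂ) := by
        simp only [Matrix.trace, Matrix.diag, Matrix.mul_apply, Matrix.conjTranspose_apply]
        refine Finset.sum_congr rfl fun j _ => Finset.sum_congr rfl fun i _ => ?_
        rw [mul_comm]
        simpa using Complex.mul_conj' (M i j)
      rw [Matrix.conjTranspose_add, Matrix.conjTranspose_one, add_mul, mul_add, mul_add,
        one_mul, mul_one, one_mul, Matrix.trace_add, Matrix.trace_add, Matrix.trace_add, this,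
        Matrix.trace_one, Matrix.trace_conjTranspose]
      ring
    rw [e] at htr
    have := congrArg Complex.re htr
    simp only [Complex.add_re, Complex.re_sum, Complex.ofReal_re, Complex.natCast_re,
      RCLike.star_def, Complex.conj_re] at this
    rw [Finset.sum_sub_distrib]
    simp only [Finset.sum_const, Finset.card_univ, nsmul_eq_mul, mul_one]
    have h3 : ∀ i, (RCLike.ofReal (l i) : ℂ).re = l i := fun i => rfl
    simp only [h3] at this
    linarith
  rw [h1]
  calc ∏ i, l i ≤ ∏ i, Real.exp (l i - 1) :=
        Finset.prod_le_prod (fun i _ => hl i) fun i _ => by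
          have := Real.add_one_le_exp (l i - 1); linarith
    _ = Real.exp (2 * M.trace.re + ∑ j, ∑ i, ‖M i j‖ ^ 2) := by rw [← Real.exp_sum, h2]
    _ ≤ _ := by
      gcongr
      exact Complex.re_le_norm _

open Classical in
/-- The determinant of the finite section of `1 + T` along `b i`, `i ∈ s`. -/
def sectionDet {ι : Type u} (b : ι → H) (s : Finset ι) (T : H →L[ℂ] H) : ℂ :=
  Matrix.det (1 + Matrix.of fun i j : s => inner ℂ (b (i : ι)) (T (b (j : ι))))

theorem hasFredholmDet_iff {T : H →L[ℂ] H} {d : ℂ} :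
    HasFredholmDet T d ↔ ∀ (ι : Type u) (b : HilbertBasis ι ℂ H),
      Tendsto (fun s => sectionDet b s T) atTop (𝓝 d) := Iff.rfl

variable [CompleteSpace H]

/-- Testing with S = T† and one unit vector ξ gives ‖T ξ‖² ≤ ‖T‖ c; a factor ‖T‖ then cancels. -/
theorem TraceNormLE.norm_le {T : H →L[ℂ] H} {c : ℝ} (h : TraceNormLE T c) (hc : 0 ≤ c) :
    ‖T‖ ≤ c := by
  have key : ‖T‖ ≤ Real.sqrt (‖T‖ * c) := by
    refine ContinuousLinearMap.opNorm_le_of_unit_norm (Real.sqrt_nonneg _) fun ξ hξ => ?_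
    refine Real.le_sqrt_of_sq_le ?_
    have hb : Orthonormal ℂ (fun _ : PUnit.{u + 1} => ξ) := by
      constructor
      · intro _; exact hξ
      · intro i j hij; exact absurd (Subsingleton.elim i j) hij
    have h1 := h (ContinuousLinearMap.adjoint T) _ _ hb Finset.univ
    rw [Finset.univ_unique, Finset.sum_singleton, ContinuousLinearMap.adjoint_inner_right,
      inner_self_eq_norm_sq_to_K] at h1
    simpa using h1
  rcases eq_or_lt_of_le (norm_nonneg T) with h0 | h0
  · rw [← h0]; exact hc
  · have := Real.sq_sqrt (mul_nonneg h0.le hc)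
    have h2 : ‖T‖ * ‖T‖ ≤ ‖T‖ * c := by
      rw [← this, ← sq]; gcongr
    exact le_of_mul_le_mul_left h2 h0

/-- S = 1 bounds the trace of the section by c, and S = T† bounds its squared Hilbert–Schmidt norm
by ‖T‖ c ≤ c². -/
theorem TraceNormLE.norm_sectionDet_le {T : H →L[ℂ] H} {c : ℝ} (h : TraceNormLE T c)
    (hc : 0 ≤ c) {ι : Type u} {b : ι → H} (hb : Orthonormal ℂ b) (s : Finset ι) :
    ‖sectionDet b s T‖ ≤ Real.exp (c + c ^ 2) := by
  classical
  refine le_of_sq_le_sq ?_ (Real.exp_pos _).le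
  rw [← Real.exp_nat_mul]
  refine (Matrix.norm_det_sq_le_exp _).trans (Real.exp_le_exp.2 ?_)
  have h1 : ‖(Matrix.of fun i j : s => inner ℂ (b (i : ι)) (T (b (j : ι)))).trace‖ ≤ c := by
    have := h 1 ι b hb s
    simp only [one_apply_eq_self] at this
    rw [← Finset.sum_coe_sort] at this
    refine this.trans ?_
    exact mul_le_of_le_one_left hc ContinuousLinearMap.norm_id_le
  have h2 : ∑ j : s, ∑ i : s, ‖inner ℂ (b (i : ι)) (T (b (j : ι)))‖ ^ 2 ≤ c ^ 2 := by
    calc ∑ j : s, ∑ i : s, ‖inner ℂ (b (i : ι)) (T (b (j : ι)))‖ ^ 2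
        ≤ ∑ j : s, ‖T (b (j : ι))‖ ^ 2 := by
          refine Finset.sum_le_sum fun j _ => ?_
          rw [Finset.sum_coe_sort s fun i => ‖inner ℂ (b i) (T (b (j : ι)))‖ ^ 2]
          exact hb.sum_inner_products_le _
      _ = ∑ j ∈ s, ‖T (b j)‖ ^ 2 := Finset.sum_coe_sort s fun j => ‖T (b j)‖ ^ 2
      _ ≤ ‖ContinuousLinearMap.adjoint T‖ * c := by
          refine le_trans (le_of_eq ?_) (h (ContinuousLinearMap.adjoint T) ι b hb s)
          have : ∑ i ∈ s, inner ℂ (b i) (ContinuousLinearMap.adjoint T (T (b i)))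
              = ((∑ i ∈ s, ‖T (b i)‖ ^ 2 : ℝ) : ℂ) := by
            push_cast
            refine Finset.sum_congr rfl fun i _ => ?_
            rw [ContinuousLinearMap.adjoint_inner_right, inner_self_eq_norm_sq_to_K]
            rfl
          rw [this, Complex.norm_real, Real.norm_of_nonneg]
          exact Finset.sum_nonneg fun _ _ => by positivity
      _ ≤ c ^ 2 := by
          rw [LinearIsometryEquiv.norm_map, sq]
          gcongr
          exact h.norm_le hc
  simp only [Matrix.of_apply]
  push_cast
  nlinarith [sq_nonneg c]

/-- Schwarz lemma for t ↦ det (1 + T + tN) on the disc |t| < 1/d, where T + tN has trace norm at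
most c + 1; d < 1 puts t = 1 inside the disc. -/
theorem TraceNormLE.norm_sectionDet_sub_le {T N : H →L[ℂ] H} {c d : ℝ} (hT : TraceNormLE T c)
    (hN : TraceNormLE N d) (hc : 0 ≤ c) (hd : 0 ≤ d) (hd1 : d < 1)
    {ι : Type u} {b : ι → H} (hb : Orthonormal ℂ b) (s : Finset ι) :
    ‖sectionDet b s (T + N) - sectionDet b s T‖ ≤ 2 * Real.exp ((c + 1) + (c + 1) ^ 2) * d := by
  classical
  rcases eq_or_lt_of_le hd with rfl | hd
  · have : N = 0 := norm_le_zero_iff.1 (hN.norm_le le_rfl)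
    simp [this]
  set K := Real.exp ((c + 1) + (c + 1) ^ 2)
  have hdiff : Differentiable ℂ fun t : ℂ => sectionDet b s (T + t • N) := by
    unfold sectionDet
    simp only [Matrix.det_apply]
    refine Differentiable.fun_sum fun σ _ => Differentiable.const_smul ?_ _
    refine Differentiable.fun_finsetProd fun i _ => ?_
    simp only [Matrix.add_apply, Matrix.of_apply, add_apply,
      smul_apply, inner_add_right, inner_smul_right]
    fun_prop
  have hbd : ∀ t : ℂ, ‖t‖ ≤ 1 / d → ‖sectionDet b s (T + t • N)‖ ≤ K := by
    intro t ht
    have h1 : ‖t‖ * d ≤ 1 := by rwa [le_div_iff₀ hd] at ht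
    exact ((hT.add_smul hN t).mono (by linarith)).norm_sectionDet_le (by linarith) hb s
  have := Complex.dist_le_div_mul_dist_of_mapsTo_ball (f := fun t : ℂ => sectionDet b s (T + t • N))
    (c := 0) (z := 1) (R₁ := 1 / d) (R₂ := 2 * K) hdiff.differentiableOn
    (fun t ht => by
      rw [mem_closedBall_iff_norm]
      have h1 := hbd t (by simpa using (mem_ball_iff_norm.1 ht).le)
      have h2 := hbd 0 (by simp [hd.le])
      exact (norm_sub_le _ _).trans (by linarith))
    (by rw [mem_ball_iff_norm]; simpa using one_lt_inv_iff₀.2 ⟨hd, hd1⟩)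
  simpa [dist_eq_norm, div_eq_mul_inv] using this

end DeterminantBounds

/-! ### Existence and holomorphy of the Fredholm determinant -/

section FredholmDeterminant

variable {H : Type u} [NormedAddCommGroup H] [InnerProductSpace ℂ H]

/-- The finite-rank operator `∑_{n < N} ⟪yₙ, ·⟫ xₙ`. -/
def rankOneSum (x y : ℕ → H) (N : ℕ) : H →L[ℂ] H :=
  ∑ n ∈ Finset.range N, (innerSL ℂ (y n)).smulRight (x n)

theorem rankOneSum_apply (x y : ℕ → H) (N : ℕ) (ξ : H) :
    rankOneSum x y N ξ = ∑ n ∈ Finset.range N, inner ℂ (y n) ξ • x n := by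
  simp [rankOneSum]

/-- The determinant of the `N × N` matrix `δₙₘ + ⟪yₙ, xₘ⟫`, which is the Fredholm determinant of
`1 + ∑_{n < N} ⟪yₙ, ·⟫ xₙ`. -/
def gramDet (x y : ℕ → H) (N : ℕ) : ℂ :=
  Matrix.det (1 + Matrix.of fun n m : Fin N => inner ℂ (y n) (x m))

/-- The identity det (1 + PQ) = det (1 + QP) trades a matrix growing with `s` for one of fixed size
N, whose entries converge by Parseval. -/
theorem sectionDet_rankOneSum {ι : Type u} (b : ι → H) (s : Finset ι) (x y : ℕ → H) (N : ℕ) :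
    sectionDet b s (rankOneSum x y N) =
      Matrix.det (1 + Matrix.of fun n m : Fin N =>
        ∑ i ∈ s, inner ℂ (y n) (b i) * inner ℂ (b i) (x m)) := by
  classical
  have h1 : (Matrix.of fun i j : s => inner ℂ (b (i : ι)) (rankOneSum x y N (b (j : ι))))
      = (Matrix.of fun (i : s) (n : Fin N) => inner ℂ (b (i : ι)) (x n)) *
        (Matrix.of fun (n : Fin N) (j : s) => inner ℂ (y n) (b (j : ι))) := by
    ext i j
    simp only [Matrix.of_apply, Matrix.mul_apply, rankOneSum_apply, inner_sum, inner_smul_right]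
    rw [Finset.sum_range]
    exact Finset.sum_congr rfl fun _ _ => mul_comm _ _
  have h2 : (Matrix.of fun (n : Fin N) (j : s) => inner ℂ (y n) (b (j : ι))) *
      (Matrix.of fun (i : s) (n : Fin N) => inner ℂ (b (i : ι)) (x n)) =
      Matrix.of fun n m : Fin N => ∑ i ∈ s, inner ℂ (y n) (b i) * inner ℂ (b i) (x m) := by
    ext n m
    simp only [Matrix.of_apply, Matrix.mul_apply]
    exact Finset.sum_coe_sort s fun i => inner ℂ (y n) (b i) * inner ℂ (b i) (x m)
  rw [← h2, ← Matrix.det_one_add_mul_comm, ← h1]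
  unfold sectionDet
  congr!

theorem continuous_det_one_add_of {X : Type*} [TopologicalSpace X] {N : ℕ}
    {f : Fin N → Fin N → X → ℂ} (hf : ∀ n m, Continuous (f n m)) :
    Continuous fun z => Matrix.det (1 + Matrix.of fun n m => f n m z) := by
  refine Continuous.matrix_det (continuous_const.add ?_)
  exact continuous_matrix fun n m => hf n m

theorem tendsto_sectionDet_rankOneSum {ι : Type u} (b : HilbertBasis ι ℂ H) (x y : ℕ → H) (N : ℕ) :
    Tendsto (fun s => sectionDet b s (rankOneSum x y N)) atTop (𝓝 (gramDet x y N)) := by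
  simp only [sectionDet_rankOneSum]
  have hc : Continuous fun M : Fin N → Fin N → ℂ =>
      Matrix.det (1 + Matrix.of fun n m => M n m) :=
    continuous_det_one_add_of fun n m => by fun_prop
  refine (hc.tendsto fun n m => inner ℂ (y n) (x m)).comp ?_
  refine tendsto_pi_nhds.2 fun n => tendsto_pi_nhds.2 fun m => ?_
  exact b.hasSum_inner_mul_inner (y n) (x m)

/-- The Lipschitz constant of the Fredholm determinant on operators of trace norm at most `c`. -/
def detLipschitz (c : ℝ) : ℝ := 2 * Real.exp ((c + 1) + (c + 1) ^ 2)

variable [CompleteSpace H]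

theorem norm_sectionDet_rankOneSum_sub_le {T : H →L[ℂ] H} {x y : ℕ → H} {a : ℕ → ℝ}
    (hT : ∀ ξ : H, HasSum (fun n => inner ℂ (y n) ξ • x n) (T ξ)) (ha : Summable a)
    (hxy : ∀ n, ‖x n‖ * ‖y n‖ ≤ a n) {N : ℕ} (hN : ∑' n, a (n + N) < 1)
    {ι : Type u} {b : ι → H} (hb : Orthonormal ℂ b) (s : Finset ι) :
    ‖sectionDet b s (rankOneSum x y N) - sectionDet b s T‖ ≤
      detLipschitz (∑' n, a n) * ∑' n, a (n + N) := by
  have ha0 : ∀ n, 0 ≤ a n := fun n => (by positivity : 0 ≤ ‖x n‖ * ‖y n‖).trans (hxy n)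
  have h2 : TraceNormLE (rankOneSum x y N - T) (∑' n, a (n + N)) := by
    refine TraceNormLE.of_hasSum (x := fun n => -x (n + N)) (y := fun n => y (n + N))
      (fun ξ => ?_) ((summable_nat_add_iff N).2 ha) fun n => by simpa using hxy (n + N)
    have := ((hasSum_nat_add_iff' N).2 (hT ξ)).neg
    simpa [rankOneSum_apply] using this
  have := (TraceNormLE.of_hasSum hT ha hxy).norm_sectionDet_sub_le h2 (tsum_nonneg ha0)
    (tsum_nonneg fun n => ha0 _) hN hb s
  rwa [add_sub_cancel] at this

/-- Trace class operators have a Fredholm determinant, and the determinants of the truncated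
nuclear series converge to it at a rate which depends only on a majorant of the series. -/
theorem exists_hasFredholmDet {T : H →L[ℂ] H} {x y : ℕ → H} {a : ℕ → ℝ}
    (hT : ∀ ξ : H, HasSum (fun n => inner ℂ (y n) ξ • x n) (T ξ)) (ha : Summable a)
    (hxy : ∀ n, ‖x n‖ * ‖y n‖ ≤ a n) :
    ∃ d, HasFredholmDet T d ∧ ∀ N, ∑' n, a (n + N) < 1 →
      ‖d - gramDet x y N‖ ≤ detLipschitz (∑' n, a n) * ∑' n, a (n + N) := by
  set K := detLipschitz (∑' n, a n)
  set ν : ℕ → ℝ := fun N => ∑' n, a (n + N)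
  have hν : Tendsto ν atTop (𝓝 0) := tendsto_sum_nat_add a
  have hKν : Tendsto (fun N => K * ν N) atTop (𝓝 0) := by simpa using hν.const_mul K
  have hsec : ∀ N, ν N < 1 → ∀ (ι : Type u) (b : HilbertBasis ι ℂ H) (s : Finset ι),
      ‖sectionDet b s (rankOneSum x y N) - sectionDet b s T‖ ≤ K * ν N :=
    fun N hN ι b s => norm_sectionDet_rankOneSum_sub_le hT ha hxy hN b.orthonormal s
  -- Both determinants are compared with the same section of `T` in one auxiliary basis. The numbers
  -- `gramDet x y N` involve no basis, hence neither does their limit.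
  have hcomp : ∀ N M, ν N < 1 → ν M < 1 →
      ‖gramDet x y N - gramDet x y M‖ ≤ K * ν N + K * ν M := by
    intro N M hN hM
    obtain ⟨w, b, -⟩ := exists_hilbertBasis ℂ H
    refine le_of_tendsto ((tendsto_sectionDet_rankOneSum b x y N).sub
      (tendsto_sectionDet_rankOneSum b x y M)).norm (Eventually.of_forall fun s => ?_)
    have h1 := hsec N hN w b s
    have h2 := hsec M hM w b s
    rw [norm_sub_rev] at h2
    refine le_trans ?_ (add_le_add h1 h2)
    refine le_trans (le_of_eq ?_) (norm_add_le _ _)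
    congr 1; ring
  have hev : ∀ᶠ N in atTop, ν N < 1 := hν.eventually_lt_const one_pos
  have hcauchy : CauchySeq (gramDet x y) := by
    rw [Metric.cauchySeq_iff']
    intro ε hε
    obtain ⟨N, hN⟩ := eventually_atTop.1
      (hev.and (hKν.eventually_lt_const (half_pos hε)))
    refine ⟨N, fun n hn => ?_⟩
    rw [dist_eq_norm]
    have := hcomp n N (hN n hn).1 (hN N le_rfl).1
    linarith [(hN n hn).2, (hN N le_rfl).2]
  obtain ⟨d, hd⟩ := cauchySeq_tendsto_of_complete hcauchy
  have hdN : ∀ N, ν N < 1 → ‖d - gramDet x y N‖ ≤ K * ν N := by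
    intro N hN
    have h1 : Tendsto (fun M => K * ν M + K * ν N) atTop (𝓝 (0 + K * ν N)) :=
      hKν.add_const _
    rw [zero_add] at h1
    refine le_of_tendsto_of_tendsto (hd.sub_const _).norm h1 ?_
    filter_upwards [hev] with M hM using hcomp M N hM hN
  refine ⟨d, hasFredholmDet_iff.2 fun ι b => ?_, hdN⟩
  rw [Metric.tendsto_nhds]
  intro ε hε
  obtain ⟨N, hN1, hN2⟩ := (hev.and (hKν.eventually_lt_const (by positivity : 0 < ε / 3))).exists
  have h3 := Metric.tendsto_nhds.1 (tendsto_sectionDet_rankOneSum b x y N) (ε / 3) (by positivity)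
  filter_upwards [h3] with s hs
  have h4 := hsec N hN1 ι b s
  have h5 := hdN N hN1
  rw [← dist_eq_norm] at h4 h5
  rw [dist_comm] at h4 h5
  calc dist (sectionDet b s T) d ≤ dist (sectionDet b s T) (sectionDet b s (rankOneSum x y N))
        + dist (sectionDet b s (rankOneSum x y N)) (gramDet x y N) + dist (gramDet x y N) d :=
        dist_triangle4 _ _ _ _
    _ < ε := by linarith

theorem hasSum_conj {E V : H →L[ℂ] H} {x y : ℕ → H}
    (hE : ∀ ξ : H, HasSum (fun n => inner ℂ (y n) ξ • x n) (E ξ)) (ξ : H) :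
    HasSum (fun n => inner ℂ (ContinuousLinearMap.adjoint V (y n)) ξ • V (x n))
      ((V * E * V) ξ) := by
  simpa [ContinuousLinearMap.adjoint_inner_left] using (hE (V ξ)).mapL V

theorem norm_mul_norm_adjoint_le (V : H →L[ℂ] H) (x y : H) :
    ‖V x‖ * ‖ContinuousLinearMap.adjoint V y‖ ≤ ‖V‖ ^ 2 * (‖x‖ * ‖y‖) := by
  have h1 := V.le_opNorm x
  have h2 := (ContinuousLinearMap.adjoint V).le_opNorm y
  rw [LinearIsometryEquiv.norm_map] at h2
  calc _ ≤ (‖V‖ * ‖x‖) * (‖V‖ * ‖y‖) := by gcongr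
    _ = _ := by ring

theorem IsTraceClass.conj {E : H →L[ℂ] H} (hE : IsTraceClass E) (V : H →L[ℂ] H) :
    IsTraceClass (V * E * V) := by
  obtain ⟨x, y, hs, h⟩ := hE
  refine ⟨fun n => V (x n), fun n => ContinuousLinearMap.adjoint V (y n), ?_, hasSum_conj h⟩
  exact Summable.of_nonneg_of_le (fun _ => by positivity)
    (fun n => norm_mul_norm_adjoint_le V (x n) (y n)) (hs.mul_left _)

theorem gramDet_conj (V : H →L[ℂ] H) (x y : ℕ → H) (N : ℕ) :
    gramDet (fun n => V (x n)) (fun n => ContinuousLinearMap.adjoint V (y n)) N =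
      Matrix.det (1 + Matrix.of fun n m : Fin N => inner ℂ (y n) (V (V (x m)))) := by
  simp only [gramDet, ContinuousLinearMap.adjoint_inner_left]

/-- If `V` depends holomorphically on `z` and `E` is trace class then `det (1 + V z E V z)` is
entire. It is the locally uniform limit of the determinants of the truncated nuclear series. -/
theorem exists_entire_fredholmDet {E : H →L[ℂ] H} {x y : ℕ → H}
    (hs : Summable fun n => ‖x n‖ * ‖y n‖)
    (hE : ∀ ξ : H, HasSum (fun n => inner ℂ (y n) ξ • x n) (E ξ))
    {V : ℂ → H →L[ℂ] H} (hV : Differentiable ℂ V) :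
    ∃ τ : ℂ → ℂ, (∀ z, HasFredholmDet (V z * E * V z) (τ z)) ∧ Differentiable ℂ τ ∧
      ∀ m ε : ℝ, 0 < ε → ∀ᶠ N in atTop, ∀ z, ‖V z‖ ≤ m →
        ‖τ z - Matrix.det (1 + Matrix.of fun n k : Fin N => inner ℂ (y n) (V z (V z (x k))))‖
          < ε := by
  have key : ∀ z, ∃ d, HasFredholmDet (V z * E * V z) d ∧ ∀ m : ℝ, ‖V z‖ ≤ m → ∀ N,
      ∑' n, m ^ 2 * (‖x (n + N)‖ * ‖y (n + N)‖) < 1 →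
      ‖d - Matrix.det (1 + Matrix.of fun n k : Fin N => inner ℂ (y n) (V z (V z (x k))))‖ ≤
        detLipschitz (∑' n, m ^ 2 * (‖x n‖ * ‖y n‖)) *
          ∑' n, m ^ 2 * (‖x (n + N)‖ * ‖y (n + N)‖) := by
    intro z
    have hle : ∀ m : ℝ, ‖V z‖ ≤ m → ∀ n,
        ‖V z (x n)‖ * ‖ContinuousLinearMap.adjoint (V z) (y n)‖ ≤ m ^ 2 * (‖x n‖ * ‖y n‖) :=
      fun m hm n => (norm_mul_norm_adjoint_le _ _ _).trans (by gcongr)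
    obtain ⟨d, hd, -⟩ := exists_hasFredholmDet (hasSum_conj (V := V z) hE) (hs.mul_left _)
      (hle _ le_rfl)
    refine ⟨d, hd, fun m hm N hN => ?_⟩
    -- The value `d` is fixed before `m`; uniqueness of the determinant transfers the estimate with
    -- the majorant for `m`, which does not depend on `z`.
    obtain ⟨d', hd', h⟩ := exists_hasFredholmDet (hasSum_conj (V := V z) hE) (hs.mul_left _)
      (hle _ hm)
    rw [hd.unique hd', ← gramDet_conj]
    exact h N hN
  choose τ hτ hbound using key
  have happrox : ∀ m ε : ℝ, 0 < ε → ∀ᶠ N in atTop, ∀ z, ‖V z‖ ≤ m →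
      ‖τ z - Matrix.det (1 + Matrix.of fun n k : Fin N => inner ℂ (y n) (V z (V z (x k))))‖
        < ε := by
    intro m ε hε
    have h0 := tendsto_sum_nat_add fun n => m ^ 2 * (‖x n‖ * ‖y n‖)
    have h1 := h0.const_mul (detLipschitz (∑' n, m ^ 2 * (‖x n‖ * ‖y n‖)))
    rw [mul_zero] at h1
    filter_upwards [h0.eventually_lt_const one_pos, h1.eventually_lt_const hε] with N hN hN' z hz
    exact (hbound z m hz N hN).trans_lt hN'
  refine ⟨τ, hτ, ?_, happrox⟩
  have hlim : TendstoLocallyUniformlyOn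
      (fun N z => Matrix.det (1 + Matrix.of fun n k : Fin N => inner ℂ (y n) (V z (V z (x k)))))
      τ atTop Set.univ := by
    rw [tendstoLocallyUniformlyOn_univ, Metric.tendstoLocallyUniformly_iff]
    intro ε hε z
    refine ⟨{w | ‖V w‖ < ‖V z‖ + 1}, ?_, ?_⟩
    · exact (isOpen_lt hV.continuous.norm continuous_const).mem_nhds (by simp)
    · filter_upwards [happrox (‖V z‖ + 1) ε hε] with N hN w hw
      rw [dist_eq_norm]
      exact hN w (le_of_lt hw)
  rw [← differentiableOn_univ]
  refine hlim.differentiableOn (Eventually.of_forall fun N => ?_) isOpen_univ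
  refine Differentiable.differentiableOn ?_
  simp only [Matrix.det_apply]
  refine Differentiable.fun_sum fun σ _ => Differentiable.const_smul ?_ _
  refine Differentiable.fun_finsetProd fun i _ => ?_
  simp only [Matrix.add_apply, Matrix.of_apply]
  refine (differentiable_const _).add ?_
  refine (innerSL ℂ (y (σ i))).differentiable.comp ?_
  exact hV.clm_apply (hV.clm_apply (differentiable_const _))

end FredholmDeterminant

/-! ### Bounded generators and the operator exponential -/

section BoundedGenerator

variable {H : Type u} [NormedAddCommGroup H] [InnerProductSpace ℂ H]

theorem anticommutatorEq_iff_of_mem_graph {A : H →ₗ.[ℂ] H} {A₁ R Q : H →L[ℂ] H}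
    (hA : ∀ ξ, (ξ, A₁ ξ) ∈ A.graph) : AnticommutatorEq A R Q ↔ A₁ * R + R * A₁ = Q := by
  have hdom : ∀ ξ, ∃ h : ξ ∈ A.domain, A ⟨ξ, h⟩ = A₁ ξ := by
    intro ξ
    obtain ⟨y, hy, hy'⟩ := A.mem_graph_iff.1 (hA ξ)
    dsimp only at hy hy'
    subst hy
    exact ⟨y.2, hy'⟩
  constructor
  · intro h
    ext ξ
    obtain ⟨hξ, e⟩ := hdom ξ
    obtain ⟨h1, h2⟩ := h ⟨ξ, hξ⟩
    rw [e, (hdom (R ξ)).2] at h2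
    exact h2
  · intro h ξ
    refine ⟨(hdom _).1, ?_⟩
    have e : A ξ = A₁ ξ := (hdom (ξ : H)).2
    rw [e, (hdom (R ξ)).2, ← h]
    rfl

theorem LinearSystem.exists_mem_graph_of_hasBoundedA {H₀ : Type v} [NormedAddCommGroup H₀]
    [InnerProductSpace ℂ H₀] (L : LinearSystem H H₀) (h : L.HasBoundedA) :
    ∃ A : H →L[ℂ] H, ∀ ξ, (ξ, A ξ) ∈ L.A.graph := by
  obtain ⟨hdom, c, hc⟩ := h
  have hmem : ∀ ξ, ξ ∈ L.A.domain := fun ξ => hdom ▸ Submodule.mem_top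
  let A : H →ₗ[ℂ] H := L.A.toFun.comp (LinearMap.id.codRestrict L.A.domain hmem)
  refine ⟨A.mkContinuous c fun ξ => hc ⟨ξ, hmem ξ⟩, fun ξ => ?_⟩
  exact L.A.mem_graph ⟨ξ, hmem ξ⟩

variable [CompleteSpace H]

/-- The entire operator function `z ↦ e^{-zA}` of a bounded operator `A`. -/
def expNeg (A : H →L[ℂ] H) (z : ℂ) : H →L[ℂ] H := NormedSpace.exp (z • (-A))

theorem expNeg_zero (A : H →L[ℂ] H) : expNeg A 0 = 1 := by simp [expNeg]

theorem expNeg_add (A : H →L[ℂ] H) (z w : ℂ) : expNeg A (z + w) = expNeg A z * expNeg A w := by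
  unfold expNeg
  rw [add_smul]
  let _ := NormedAlgebra.restrictScalars ℚ ℂ (H →L[ℂ] H)
  exact NormedSpace.exp_add_of_commute (((Commute.refl (-A)).smul_left z).smul_right w)

theorem hasDerivAt_expNeg (A : H →L[ℂ] H) (z : ℂ) :
    HasDerivAt (expNeg A) (-(expNeg A z * A)) z := by
  have := hasDerivAt_exp_smul_const (-A) z
  rwa [mul_neg] at this

theorem hasDerivAt_expNeg' (A : H →L[ℂ] H) (z : ℂ) :
    HasDerivAt (expNeg A) (-(A * expNeg A z)) z := by
  have := hasDerivAt_exp_smul_const' (-A) z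
  rwa [neg_mul] at this

theorem differentiable_expNeg (A : H →L[ℂ] H) : Differentiable ℂ (expNeg A) :=
  fun z => (hasDerivAt_expNeg A z).differentiableAt

theorem hasDerivAt_expNeg_conj (A E : H →L[ℂ] H) (z : ℂ) :
    HasDerivAt (fun z => expNeg A z * E * expNeg A z)
      (-(A * (expNeg A z * E * expNeg A z) + expNeg A z * E * expNeg A z * A)) z := by
  have h := ((hasDerivAt_expNeg' A z).mul_const E).mul (hasDerivAt_expNeg A z)
  refine HasDerivAt.congr_deriv h ?_
  simp only [neg_mul, mul_neg, mul_assoc, neg_add]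

namespace LinearSystem

variable {H₀ : Type v} [NormedAddCommGroup H₀] [InnerProductSpace ℂ H₀]

/-- The function u ↦ e^{uA} S_u ξ is continuous with zero right derivative, hence constant.
One-sided derivatives suffice, which is all the generator provides. -/
theorem S_eq_expNeg (L : LinearSystem H H₀) {A : H →L[ℂ] H}
    (hA : ∀ ξ, (ξ, A ξ) ∈ L.A.graph) {t : ℝ} (ht : 0 ≤ t) : L.S t = expNeg A t := by
  have hder : ∀ (ξ : H) (s : ℝ), 0 ≤ s →
      HasDerivWithinAt (fun u => L.S u ξ) (-(A (L.S s ξ))) (Set.Ici s) s := by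
    intro ξ s hs
    have h1 := (L.generator (L.S s ξ) (A (L.S s ξ))).1 (hA _)
    have h2 : HasDerivWithinAt (fun u : ℝ => u - s) 1 (Set.Ici s) s :=
      (hasDerivWithinAt_id s _).sub_const s
    have h3 := HasDerivWithinAt.scomp (t' := Set.Ici (0 : ℝ)) s (by simpa using h1) h2
      (fun u hu => by simpa using hu)
    rw [one_smul] at h3
    refine h3.congr_of_mem (fun u hu => ?_) Set.self_mem_Ici
    have := L.S_add (u - s) s (sub_nonneg.2 hu) hs
    rw [sub_add_cancel] at this
    rw [this]; rfl
  have hexp : ∀ s : ℝ, HasDerivAt (fun u : ℝ => expNeg A (-(u : ℂ))) (expNeg A (-(s : ℂ)) * A) s := by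
    intro s
    have h1 : HasDerivAt (fun u : ℝ => -(u : ℂ)) (-1) s := Complex.ofRealCLM.hasDerivAt.neg
    have h2 := (hasDerivAt_expNeg A (-(s : ℂ))).scomp s h1
    rw [neg_one_smul, neg_neg] at h2
    exact h2
  have hconst : ∀ ξ, expNeg A (-(t : ℂ)) (L.S t ξ) = ξ := by
    intro ξ
    have := constant_of_has_deriv_right_zero (a := 0) (b := t)
      (f := fun u : ℝ => expNeg A (-(u : ℂ)) (L.S u ξ)) ?_ ?_ t ⟨ht, le_rfl⟩
    · simpa [expNeg_zero, L.S_zero] using this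
    · refine ContinuousOn.clm_apply (fun u _ => (hexp u).continuousAt.continuousWithinAt) ?_
      exact (L.S_continuous ξ).mono Set.Icc_subset_Ici_self
    · intro s hs
      have h1 := (ContinuousLinearMap.restrictScalarsL ℂ H H ℝ ℝ).hasFDerivAt.comp_hasDerivAt s
        (hexp s)
      simpa using h1.hasDerivWithinAt.clm_apply (hder ξ s hs.1)
  ext ξ
  have h := congrArg (expNeg A t) (hconst ξ)
  rw [← h, ← mul_apply_eq_comp, ← expNeg_add, add_neg_cancel, expNeg_zero]
  rfl

theorem exists_norm_expNeg_le (L : LinearSystem H H₀) {A : H →L[ℂ] H}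
    (hA : ∀ ξ, (ξ, A ξ) ∈ L.A.graph) : ∃ M : ℝ, ∀ t : ℝ, 0 ≤ t → ‖expNeg A t‖ ≤ M := by
  obtain ⟨M, hM⟩ := L.S_bounded
  exact ⟨M, fun t ht => L.S_eq_expNeg hA ht ▸ hM t ht⟩

theorem isLyapunovSolution_expNeg_conj [CompleteSpace H₀] (L : LinearSystem H H₀) {A E : H →L[ℂ] H}
    (hA : ∀ ξ, (ξ, A ξ) ∈ L.A.graph) (hE : A * E + E * A = L.B ∘L L.C) :
    L.IsLyapunovSolution fun z => expNeg A z * E * expNeg A z := by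
  refine ⟨fun z => (hasDerivAt_expNeg_conj A E z).differentiableAt, fun z => ?_, ?_⟩
  · rw [anticommutatorEq_iff_of_mem_graph hA, (hasDerivAt_expNeg_conj A E z).deriv, neg_neg]
  · rw [anticommutatorEq_iff_of_mem_graph hA]
    simpa [expNeg_zero] using hE

/-- A norm continuous group has a bounded generator: averaging the group over a short interval
gives an invertible operator. -/
theorem exists_mem_graph_of_group (L : LinearSystem H H₀) {U : ℝ → H →L[ℂ] H}
    (hUS : ∀ t : ℝ, 0 ≤ t → U t = L.S t) (hadd : ∀ s t : ℝ, U (s + t) = U s * U t)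
    (hU : Continuous U) : ∃ A : H →L[ℂ] H, ∀ ξ, (ξ, A ξ) ∈ L.A.graph := by
  have hint : ∀ a b : ℝ, IntervalIntegrable U volume a b := fun a b => hU.intervalIntegrable a b
  set F : ℝ → H →L[ℂ] H := fun t => ∫ s in (0 : ℝ)..t, U s
  have hF : ∀ t, HasDerivAt F (U t) t := fun t =>
    intervalIntegral.integral_hasDerivAt_right (hint _ _)
      hU.stronglyMeasurable.stronglyMeasurableAtFilter hU.continuousAt
  have hU0 : U 0 = 1 := by rw [hUS 0 le_rfl, L.S_zero]
  have hslope : Tendsto (fun t : ℝ => t⁻¹ • F t) (𝓝[≠] 0) (𝓝 1) := by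
    have := hasDerivAt_iff_tendsto_slope_zero.1 (hF 0)
    simpa [hU0, F] using this
  obtain ⟨h, hh, hh0⟩ := ((hslope.eventually
    (Units.isOpen.mem_nhds (isUnit_one (M := H →L[ℂ] H)))).and self_mem_nhdsWithin).exists
  have hunit : IsUnit (F h) := by
    have h0 : IsUnit (h • (1 : H →L[ℂ] H)) :=
      (isUnit_one (M := H →L[ℂ] H)).smul (Units.mk0 h hh0)
    have : F h = (h • (1 : H →L[ℂ] H)) * (h⁻¹ • F h) := by
      rw [smul_mul_assoc, one_mul, smul_smul, mul_inv_cancel₀ hh0, one_smul]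
    rw [this]; exact h0.mul hh
  obtain ⟨V, hV⟩ := hunit
  -- The group law gives U t · F h = F (t + h) - F t; as F is differentiable and F h invertible, U
  -- is differentiable in norm.
  have hUF : ∀ t, U t = (F (t + h) - F t) * ((V⁻¹ : (H →L[ℂ] H)ˣ) : H →L[ℂ] H) := by
    intro t
    rw [Units.eq_mul_inv_iff_mul_eq, hV]
    simp only [F]
    rw [intervalIntegral.integral_interval_sub_left (hint _ _) (hint _ _)]
    have h1 := (ContinuousLinearMap.mul ℝ (H →L[ℂ] H) (U t)).intervalIntegral_comp_comm (hint 0 h)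
    simp only [ContinuousLinearMap.mul_apply', ← hadd] at h1
    rw [← h1, intervalIntegral.integral_comp_add_left, add_zero]
  have hder : ∃ D : H →L[ℂ] H, HasDerivAt U D 0 := by
    refine ⟨_, ((((hF (0 + h)).comp_add_const 0 h).sub (hF 0)).mul_const _).congr_of_eventuallyEq
      (Eventually.of_forall hUF)⟩
  obtain ⟨D, hD⟩ := hder
  refine ⟨-D, fun ξ => (L.generator _ _).2 ?_⟩
  have h1 := (((ContinuousLinearMap.apply ℂ H ξ).restrictScalars ℝ).hasFDerivAt.comp_hasDerivAt
    (0 : ℝ) hD).hasDerivWithinAt (s := Set.Ici 0)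
  refine (h1.congr_of_mem (fun t ht => ?_) Set.self_mem_Ici).congr_deriv (by simp)
  rw [← hUS t ht]; rfl

end LinearSystem

end BoundedGenerator

/-! ### Hilbert–Schmidt operators and nuclear series -/

section HilbertSchmidt

variable {E : Type*} {F : Type*} [NormedAddCommGroup E] [InnerProductSpace ℂ E]
  [NormedAddCommGroup F] [InnerProductSpace ℂ F]

theorem HilbertBasis.hasSum_norm_inner_sq {ι : Type*} (b : HilbertBasis ι ℂ E) (x : E) :
    HasSum (fun i => ‖inner ℂ (b i) x‖ ^ 2) (‖x‖ ^ 2) := by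
  have h := b.hasSum_inner_mul_inner x x
  have e : ∀ i, inner ℂ x (b i) * inner ℂ (b i) x = ((‖inner ℂ (b i) x‖ ^ 2 : ℝ) : ℂ) := by
    intro i
    rw [← inner_conj_symm x (b i), Complex.conj_mul']
    push_cast; rfl
  have e' : inner ℂ x x = ((‖x‖ ^ 2 : ℝ) : ℂ) := by
    rw [inner_self_eq_norm_sq_to_K]; push_cast; rfl
  simp only [e, e'] at h
  exact Complex.hasSum_ofReal.1 h

variable [CompleteSpace E] [CompleteSpace F]

/-- The nonnegative double series of |⟪f_j, T b_i⟫|² may be summed in either order. Applied twice,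
this shows that the Hilbert–Schmidt condition does not depend on the basis. -/
theorem HilbertBasis.summable_norm_adjoint_sq {ι κ : Type*} (b : HilbertBasis ι ℂ E)
    (f : HilbertBasis κ ℂ F) {T : E →L[ℂ] F} (h : Summable fun i => ‖T (b i)‖ ^ 2) :
    Summable fun j => ‖ContinuousLinearMap.adjoint T (f j)‖ ^ 2 := by
  have h1 : Summable fun p : ι × κ => ‖inner ℂ (f p.2) (T (b p.1))‖ ^ 2 := by
    refine (summable_prod_of_nonneg fun p => by positivity).2
      ⟨fun i => (f.hasSum_norm_inner_sq (T (b i))).summable, ?_⟩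
    simpa only [(f.hasSum_norm_inner_sq _).tsum_eq] using h
  refine h1.prod_symm.prod.congr fun j => ?_
  rw [← (b.hasSum_norm_inner_sq _).tsum_eq]
  refine tsum_congr fun i => ?_
  rw [ContinuousLinearMap.adjoint_inner_right, norm_inner_symm]
  rfl

theorem IsHilbertSchmidt.summable {T : E →L[ℂ] F} (h : IsHilbertSchmidt T) {ι : Type*}
    (b : HilbertBasis ι ℂ E) : Summable fun i => ‖T (b i)‖ ^ 2 := by
  obtain ⟨w, b', h'⟩ := h
  obtain ⟨v, f, -⟩ := exists_hilbertBasis ℂ F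
  have := f.summable_norm_adjoint_sq b (b'.summable_norm_adjoint_sq f h')
  simpa using this

/-- The product `X Y†` of Hilbert--Schmidt operators has a nuclear series with left vectors in the
range of `X`. -/
theorem IsHilbertSchmidt.exists_nuclear_series {X Y : E →L[ℂ] F} (hX : IsHilbertSchmidt X)
    (hY : IsHilbertSchmidt Y) :
    ∃ x y : ℕ → F, (Summable fun n => ‖x n‖ * ‖y n‖) ∧
      (∀ ξ : F, HasSum (fun n => inner ℂ (y n) ξ • x n)
        ((X ∘L ContinuousLinearMap.adjoint Y) ξ)) ∧ ∀ n, ∃ f, X f = x n := by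
  obtain ⟨w, b, -⟩ := exists_hilbertBasis ℂ E
  have hXs := hX.summable b
  -- The basis may be uncountable, but only countably many X b_i are nonzero; these are indexed by ℕ
  -- through `g`, with zeros elsewhere.
  have hcount : (Function.support fun i => ‖X (b i)‖ ^ 2).Countable := hXs.countable_support
  set S := Function.support fun i => ‖X (b i)‖ ^ 2
  have hS : ∀ i, i ∉ S → X (b i) = 0 := by
    intro i hi
    simpa [S] using hi
  obtain ⟨g, hg⟩ := hcount.to_subtype.exists_injective_nat
  have hsum : Summable fun i => ‖X (b i)‖ * ‖Y (b i)‖ := by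
    refine Summable.of_nonneg_of_le (fun _ => by positivity) (fun i => ?_)
      (hXs.add (hY.summable b))
    nlinarith [sq_nonneg (‖X (b i)‖ - ‖Y (b i)‖), sq_nonneg (‖X (b i)‖),
      sq_nonneg (‖Y (b i)‖)]
  refine ⟨Function.extend g (fun i => X (b i)) 0, Function.extend g (fun i => Y (b i)) 0,
    ?_, fun ξ => ?_, fun n => ?_⟩
  · have h1 : HasSum ((fun i => ‖X (b i)‖ * ‖Y (b i)‖) ∘ ((↑) : S → w)) (∑' i, ‖X (b i)‖ * ‖Y (b i)‖) :=
      (hasSum_subtype_iff_of_support_subset (fun i hi => by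
        by_contra h; exact hi (by simp [hS i h]))).2 hsum.hasSum
    refine ((hasSum_extend_zero hg).2 h1).summable.congr fun n => ?_
    by_cases hn : ∃ i, g i = n
    · obtain ⟨i, rfl⟩ := hn
      simp [hg.extend_apply]
    · simp [Function.extend_apply' _ _ _ hn]
  · have h0 : HasSum (fun i => inner ℂ (Y (b i)) ξ • X (b i))
        ((X ∘L ContinuousLinearMap.adjoint Y) ξ) := by
      have := (b.hasSum_repr (ContinuousLinearMap.adjoint Y ξ)).mapL X
      simpa [b.repr_apply_apply, ContinuousLinearMap.adjoint_inner_right] using this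
    have h1 := (hasSum_subtype_iff_of_support_subset (s := S) (fun i hi => by
        by_contra h; exact hi (by simp [hS i h]))).2 h0
    refine ((hasSum_extend_zero hg).2 h1).congr_fun fun n => ?_
    by_cases hn : ∃ i, g i = n
    · obtain ⟨i, rfl⟩ := hn
      simp [hg.extend_apply]
    · simp [Function.extend_apply' _ _ _ hn]
  · by_cases hn : ∃ i, g i = n
    · obtain ⟨i, rfl⟩ := hn
      exact ⟨b i, by simp [hg.extend_apply]⟩
    · exact ⟨0, by simp [Function.extend_apply' _ _ _ hn]⟩

end HilbertSchmidt

/-! ### Adjoints of integral operators on the half-line -/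

section IntegralOperators

variable {H : Type u} {H₀ : Type v}
  [NormedAddCommGroup H] [InnerProductSpace ℂ H] [CompleteSpace H]
  [NormedAddCommGroup H₀] [InnerProductSpace ℂ H₀] [CompleteSpace H₀]

/-- The adjoint of the operator `f ↦ ∫₀^∞ K s f(s) ds` is `ξ ↦ K(·)† ξ`. -/
theorem adjoint_ae_eq_of_forall_eq_integral {K : ℝ → H₀ →L[ℂ] H} (hK : Continuous K) {M : ℝ}
    (hM : ∀ t, 0 ≤ t → ‖K t‖ ≤ M) {Φ : HalfLineL2 H₀ →L[ℂ] H}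
    (hΦ : ∀ f : HalfLineL2 H₀, Integrable f (volume.restrict (Set.Ioi (0 : ℝ))) →
      Φ f = ∫ s in Set.Ioi (0 : ℝ), K s (f s)) (ξ : H) :
    ContinuousLinearMap.adjoint Φ ξ =ᵐ[volume.restrict (Set.Ioi (0 : ℝ))]
      fun s => ContinuousLinearMap.adjoint (K s) ξ := by
  set μ := volume.restrict (Set.Ioi (0 : ℝ))
  have hpos : ∀ᵐ s ∂μ, 0 ≤ s := by
    filter_upwards [ae_restrict_mem measurableSet_Ioi] with s hs using le_of_lt hs
  have hK' : Continuous fun s => ContinuousLinearMap.adjoint (K s) ξ :=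
    (ContinuousLinearMap.adjoint.continuous.comp hK).clm_apply continuous_const
  have hint' : ∀ s, μ s < ⊤ → IntegrableOn (fun s => ContinuousLinearMap.adjoint (K s) ξ) s μ := by
    intro s hs
    refine Measure.integrableOn_of_bounded (M := M * ‖ξ‖) hs.ne hK'.aestronglyMeasurable ?_
    filter_upwards [ae_restrict_of_ae hpos] with t ht
    refine (ContinuousLinearMap.le_opNorm _ _).trans ?_
    rw [LinearIsometryEquiv.norm_map]
    gcongr
    exact hM t ht
  have hintc : ∀ s, μ s < ⊤ → ∀ c, IntegrableOn (fun s => K s c) s μ := by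
    intro s hs c
    refine Measure.integrableOn_of_bounded (M := M * ‖c‖) hs.ne
      (hK.clm_apply continuous_const).aestronglyMeasurable ?_
    filter_upwards [ae_restrict_of_ae hpos] with t ht
    refine (ContinuousLinearMap.le_opNorm _ _).trans ?_
    gcongr
    exact hM t ht
  -- Both sides are compared by integrals over sets of finite measure, paired with a vector `c`. The
  -- test functions 1_s c lie in L¹ ∩ L², where the integral formula for `Φ` is available.
  refine ae_eq_of_forall_setIntegral_eq_of_sigmaFinite
    (fun s _ hs => integrableOn_Lp_of_measure_ne_top _ (by norm_num) hs.ne)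
    (fun s _ hs => hint' s hs) fun s hs hμs => ?_
  refine ext_inner_left ℂ fun c => ?_
  rw [← L2.inner_indicatorConstLp_eq_inner_setIntegral ℂ hs hμs.ne c,
    ContinuousLinearMap.adjoint_inner_right, hΦ _ (integrable_indicatorConstLp hs hμs.ne c),
    ← integral_inner (hint' s hμs) c]
  have h1 : ∫ t, K t ((indicatorConstLp 2 hs hμs.ne c : HalfLineL2 H₀) t) ∂μ
      = ∫ t in s, K t c ∂μ := by
    rw [← integral_indicator hs]
    refine integral_congr_ae ?_
    filter_upwards [indicatorConstLp_coeFn (p := 2) (hs := hs) (hμs := hμs.ne) (c := c)] with t ht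
    rw [ht]
    by_cases hts : t ∈ s <;> simp [hts]
  rw [h1, ← inner_conj_symm, ← integral_inner (hintc s hμs c) ξ, ← integral_conj]
  refine integral_congr_ae (Eventually.of_forall fun t => ?_)
  simp only [inner_conj_symm, ContinuousLinearMap.adjoint_inner_right]

theorem integrableOn_Ioi_and_inner_eq_integral {K K' : ℝ → H₀ →L[ℂ] H}
    {u v : HalfLineL2 H₀} {ξ η : H}
    (hu : u =ᵐ[volume.restrict (Set.Ioi (0 : ℝ))] fun s => ContinuousLinearMap.adjoint (K s) ξ)
    (hv : v =ᵐ[volume.restrict (Set.Ioi (0 : ℝ))] fun s => ContinuousLinearMap.adjoint (K' s) η) :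
    IntegrableOn (fun t => inner ℂ η (K' t (ContinuousLinearMap.adjoint (K t) ξ))) (Set.Ioi 0) ∧
      inner ℂ v u = ∫ t in Set.Ioi 0, inner ℂ η (K' t (ContinuousLinearMap.adjoint (K t) ξ)) := by
  have e : (fun t => inner ℂ (v t) (u t)) =ᵐ[volume.restrict (Set.Ioi (0 : ℝ))]
      fun t => inner ℂ η (K' t (ContinuousLinearMap.adjoint (K t) ξ)) := by
    filter_upwards [hu, hv] with t h1 h2
    rw [h1, h2, ContinuousLinearMap.adjoint_inner_left]
  exact ⟨(L2.integrable_inner v u).congr e, by rw [L2.inner_def]; exact integral_congr_ae e⟩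

theorem setIntegral_Ioi_zero_comp_add (g : ℝ → ℂ) (x : ℝ) :
    ∫ t in Set.Ioi 0, g (t + x) = ∫ t in Set.Ioi x, g t := by
  have := (measurePreserving_add_right volume x).setIntegral_preimage_emb
    (measurableEmbedding_addRight x) g (Set.Ioi x)
  simpa using this

theorem tendsto_setIntegral_Ioi_zero {g : ℝ → ℂ} (hg : IntegrableOn g (Set.Ioi 0)) :
    Tendsto (fun x : ℝ => ∫ t in Set.Ioi x, g t) atTop (𝓝 0) := by
  have := tendsto_setIntegral_of_antitone (f := g) (μ := volume) (s := fun x : ℝ => Set.Ioi x)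
    (fun _ => measurableSet_Ioi) (fun _ _ h => Set.Ioi_subset_Ioi h) ⟨0, hg⟩
  have h0 : ⋂ x : ℝ, Set.Ioi x = ∅ := by
    ext t
    simp only [Set.mem_iInter, Set.mem_Ioi, Set.mem_empty_iff_false, iff_false, not_forall]
    exact ⟨t, lt_irrefl t⟩
  simpa [h0] using this

end IntegralOperators

theorem meromorphic_potential {τ : ℂ → ℂ} (hτ : Differentiable ℂ τ) : Meromorphic (potential τ) := by
  intro z
  have h : MeromorphicAt τ z := (hτ.analyticAt z).meromorphicAt
  exact (MeromorphicAt.const (-2 : ℂ) z).mul (h.deriv.div h).deriv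

/-! ### Solutions of the Lyapunov equation and their tau functions -/

section Admissible

variable {H : Type u} {H₀ : Type v}
  [NormedAddCommGroup H] [InnerProductSpace ℂ H] [CompleteSpace H]
  [NormedAddCommGroup H₀] [InnerProductSpace ℂ H₀] [CompleteSpace H₀]

namespace LinearSystem

theorem IsControllabilityOperator.adjoint_ae_eq {L : LinearSystem H H₀}
    {Ξ : HalfLineL2 H₀ →L[ℂ] H} (hΞ : L.IsControllabilityOperator Ξ) {A : H →L[ℂ] H}
    (hA : ∀ ξ, (ξ, A ξ) ∈ L.A.graph) (η : H) :
    ContinuousLinearMap.adjoint Ξ η =ᵐ[volume.restrict (Set.Ioi (0 : ℝ))]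
      fun s => ContinuousLinearMap.adjoint (expNeg A s ∘L L.B) η := by
  obtain ⟨M, hM⟩ := L.exists_norm_expNeg_le hA
  refine adjoint_ae_eq_of_forall_eq_integral (K := fun s : ℝ => expNeg A s ∘L L.B)
    (((differentiable_expNeg A).continuous.comp Complex.continuous_ofReal).clm_comp
      continuous_const) (M := M * ‖L.B‖) (fun t ht => ?_) (fun f hf => ?_) η
  · exact (ContinuousLinearMap.opNorm_comp_le _ _).trans (by gcongr; exact hM t ht)
  · rw [hΞ f hf]
    refine setIntegral_congr_fun measurableSet_Ioi fun s hs => ?_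
    simp only [L.S_eq_expNeg hA (le_of_lt hs)]
    rfl

theorem IsObservabilityOperator.adjoint_ae_eq {L : LinearSystem H H₀}
    {Θ : HalfLineL2 H₀ →L[ℂ] H} (hΘ : L.IsObservabilityOperator Θ) {A : H →L[ℂ] H}
    (hA : ∀ ξ, (ξ, A ξ) ∈ L.A.graph) (ξ : H) :
    ContinuousLinearMap.adjoint Θ ξ =ᵐ[volume.restrict (Set.Ioi (0 : ℝ))]
      fun s => ContinuousLinearMap.adjoint (ContinuousLinearMap.adjoint (L.C ∘L expNeg A s)) ξ := by
  obtain ⟨M, hM⟩ := L.exists_norm_expNeg_le hA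
  refine adjoint_ae_eq_of_forall_eq_integral
    (K := fun s : ℝ => ContinuousLinearMap.adjoint (L.C ∘L expNeg A s))
    (ContinuousLinearMap.adjoint.continuous.comp (continuous_const.clm_comp
      ((differentiable_expNeg A).continuous.comp Complex.continuous_ofReal)))
    (M := ‖L.C‖ * M) (fun t ht => ?_) (fun f hf => ?_) ξ
  · rw [LinearIsometryEquiv.norm_map]
    exact (ContinuousLinearMap.opNorm_comp_le _ _).trans (by gcongr; exact hM t ht)
  · rw [hΘ f hf]
    refine setIntegral_congr_fun measurableSet_Ioi fun s hs => ?_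
    simp only [L.S_eq_expNeg hA (le_of_lt hs), ContinuousLinearMap.adjoint_comp]
    rfl

theorem integrableOn_and_inner_eq_integral (L : LinearSystem H H₀)
    {Θ Ξ : HalfLineL2 H₀ →L[ℂ] H} (hΘ : L.IsObservabilityOperator Θ)
    (hΞ : L.IsControllabilityOperator Ξ) {A : H →L[ℂ] H} (hA : ∀ ξ, (ξ, A ξ) ∈ L.A.graph)
    (ξ η : H) :
    IntegrableOn (fun t : ℝ => inner ℂ η ((expNeg A t * (L.B ∘L L.C) * expNeg A t) ξ))
        (Set.Ioi 0) ∧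
      inner ℂ η ((Ξ ∘L ContinuousLinearMap.adjoint Θ) ξ) =
        ∫ t : ℝ in Set.Ioi 0, inner ℂ η ((expNeg A t * (L.B ∘L L.C) * expNeg A t) ξ) := by
  have := integrableOn_Ioi_and_inner_eq_integral (hΘ.adjoint_ae_eq hA ξ) (hΞ.adjoint_ae_eq hA η)
  simp only [ContinuousLinearMap.adjoint_adjoint, ContinuousLinearMap.adjoint_inner_left] at this
  exact this

/-- The function φ(t) = ⟪η, e^{-tA} B C e^{-tA} ξ⟫ and its derivative are both integrable on the
half-line. Hence φ vanishes at infinity, without any decay assumption on the semigroup, and φ(0) =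
-∫ φ'. -/
theorem lyapunov_of_operators (L : LinearSystem H H₀)
    {Θ Ξ : HalfLineL2 H₀ →L[ℂ] H} (hΘ : L.IsObservabilityOperator Θ)
    (hΞ : L.IsControllabilityOperator Ξ) {A : H →L[ℂ] H} (hA : ∀ ξ, (ξ, A ξ) ∈ L.A.graph) :
    A * (Ξ ∘L ContinuousLinearMap.adjoint Θ) + (Ξ ∘L ContinuousLinearMap.adjoint Θ) * A =
      L.B ∘L L.C := by
  set R := Ξ ∘L ContinuousLinearMap.adjoint Θ
  set Q := L.B ∘L L.C
  have key := L.integrableOn_and_inner_eq_integral hΘ hΞ hA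
  ext ξ
  refine ext_inner_left ℂ fun η => ?_
  set φ : ℝ → ℂ := fun t => inner ℂ η ((expNeg A t * Q * expNeg A t) ξ)
  set ψ : ℝ → ℂ := fun t =>
    inner ℂ (ContinuousLinearMap.adjoint A η) ((expNeg A t * Q * expNeg A t) ξ) +
      inner ℂ η ((expNeg A t * Q * expNeg A t) (A ξ))
  have hφ : ∀ t : ℝ, HasDerivAt φ (-ψ t) t := by
    intro t
    have h1 := (((innerSL ℂ η).comp (ContinuousLinearMap.apply ℂ H ξ)).hasFDerivAt.comp_hasDerivAt
      (t : ℂ) (hasDerivAt_expNeg_conj A Q t)).comp_ofReal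
    refine HasDerivAt.congr_deriv h1 ?_
    simp [ψ, ContinuousLinearMap.adjoint_inner_left, inner_add_right, inner_neg_right]
  have hψ : IntegrableOn ψ (Set.Ioi 0) := (key _ _).1.add (key _ _).1
  have h0 := tendsto_zero_of_hasDerivAt_of_integrableOn_Ioi (fun t _ => hφ t) hψ.neg (key ξ η).1
  have h1 := integral_Ioi_of_hasDerivAt_of_tendsto (hφ 0).continuousAt.continuousWithinAt
    (fun t _ => hφ t) hψ.neg h0
  rw [integral_neg, zero_sub, neg_inj,
    integral_add (key ξ (ContinuousLinearMap.adjoint A η)).1 (key (A ξ) η).1,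
    ← (key _ _).2, ← (key _ _).2, ContinuousLinearMap.adjoint_inner_left, ← inner_add_right] at h1
  simpa [φ, R, expNeg_zero] using h1

theorem isTailIntegral_expNeg_conj (L : LinearSystem H H₀)
    {Θ Ξ : HalfLineL2 H₀ →L[ℂ] H} (hΘ : L.IsObservabilityOperator Θ)
    (hΞ : L.IsControllabilityOperator Ξ) {A : H →L[ℂ] H} (hA : ∀ ξ, (ξ, A ξ) ∈ L.A.graph) :
    L.IsTailIntegral fun z =>
      expNeg A z * (Ξ ∘L ContinuousLinearMap.adjoint Θ) * expNeg A z := by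
  have key := L.integrableOn_and_inner_eq_integral hΘ hΞ hA
  intro x hx ξ η
  have e : Set.EqOn (fun t : ℝ => inner ℂ η ((expNeg A t * (L.B ∘L L.C) * expNeg A t) ξ))
      (fun t => inner ℂ η (L.S t (L.B (L.C (L.S t ξ))))) (Set.Ioi x) := by
    intro t ht
    simp only [L.S_eq_expNeg hA (hx.trans (le_of_lt ht))]
    rfl
  refine ⟨((key ξ η).1.mono_set (Set.Ioi_subset_Ioi hx)).congr_fun e measurableSet_Ioi, ?_⟩
  rw [← setIntegral_congr_fun measurableSet_Ioi e, ← setIntegral_Ioi_zero_comp_add]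
  have h := (key (expNeg A x ξ) (ContinuousLinearMap.adjoint (expNeg A x) η)).2
  rw [ContinuousLinearMap.adjoint_inner_left] at h
  refine h.trans ?_
  refine integral_congr_ae (Eventually.of_forall fun t => ?_)
  simp only [ContinuousLinearMap.adjoint_inner_left]
  push_cast
  -- The left factor must split as e^{-xA} e^{-tA} and the right one as e^{-tA} e^{-xA}, so that the
  -- outer factors come out of the integral.
  rw [expNeg_add]
  nth_rw 1 [← expNeg_add]
  rw [add_comm, expNeg_add]
  rfl

/-- The pairing equals ⟪v x, f⟫ with v x = Ξ† (e^{-xA})† η, and ‖v x‖² is the tail over (x, ∞) of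
the integral of ‖B† (e^{-tA})† η‖², which converges since Ξ†η is in L². -/
theorem IsControllabilityOperator.tendsto_inner_zero {L : LinearSystem H H₀}
    {Ξ : HalfLineL2 H₀ →L[ℂ] H} (hΞ : L.IsControllabilityOperator Ξ) {A : H →L[ℂ] H}
    (hA : ∀ ξ, (ξ, A ξ) ∈ L.A.graph) (η : H) (f : HalfLineL2 H₀) :
    Tendsto (fun x : ℝ => inner ℂ η (expNeg A x (Ξ f))) atTop (𝓝 0) := by
  set K : ℝ → H₀ →L[ℂ] H := fun t => expNeg A t ∘L L.B
  set v : ℝ → HalfLineL2 H₀ := fun x =>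
    ContinuousLinearMap.adjoint Ξ (ContinuousLinearMap.adjoint (expNeg A x) η)
  set g : ℝ → ℂ := fun t => inner ℂ η (K t (ContinuousLinearMap.adjoint (K t) η))
  have hg : IntegrableOn g (Set.Ioi 0) :=
    (integrableOn_Ioi_and_inner_eq_integral (hΞ.adjoint_ae_eq hA η) (hΞ.adjoint_ae_eq hA η)).1
  have hv : ∀ x : ℝ, inner ℂ (v x) (v x) = ∫ t in Set.Ioi x, g t := by
    intro x
    rw [← setIntegral_Ioi_zero_comp_add]
    refine (integrableOn_Ioi_and_inner_eq_integral (hΞ.adjoint_ae_eq hA _)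
      (hΞ.adjoint_ae_eq hA _)).2.trans ?_
    refine integral_congr_ae (Eventually.of_forall fun t => ?_)
    have hK : K (t + x) = expNeg A x ∘L K t := by
      simp only [K]
      push_cast
      rw [add_comm, expNeg_add]
      rfl
    simp only [g, hK, ContinuousLinearMap.adjoint_comp, ContinuousLinearMap.adjoint_inner_left]
    simp [K, ContinuousLinearMap.adjoint_comp]
  have hv0 : Tendsto (fun x => ‖v x‖) atTop (𝓝 0) := by
    have h1 : Tendsto (fun x => ‖v x‖ ^ 2) atTop (𝓝 0) := by
      have h2 := (tendsto_setIntegral_Ioi_zero hg).norm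
      rw [norm_zero] at h2
      refine h2.congr fun x => ?_
      rw [← hv, inner_self_eq_norm_sq_to_K]
      simp
    have h3 := h1.sqrt
    simpa using h3
  refine squeeze_zero_norm (a := fun x => ‖v x‖ * ‖f‖) (fun x => ?_)
    (by simpa using hv0.mul_const ‖f‖)
  rw [← ContinuousLinearMap.adjoint_inner_left, ← ContinuousLinearMap.adjoint_inner_left]
  exact norm_inner_le_norm _ _

theorem IsTwoTwoAdmissible.exists_tau {L : LinearSystem H H₀} (hL : L.IsTwoTwoAdmissible)
    {A : H →L[ℂ] H} (hA : ∀ ξ, (ξ, A ξ) ∈ L.A.graph) :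
    ∃ (R : ℂ → H →L[ℂ] H) (τ : ℂ → ℂ),
      L.IsLyapunovSolution R ∧ L.IsTailIntegral R ∧
      (∀ z, IsTraceClass (R z) ∧ HasFredholmDet (R z) (τ z)) ∧
      Differentiable ℂ τ ∧ ∃ z, τ z ≠ 0 := by
  obtain ⟨⟨Θ, hΘ, hΘ2⟩, Ξ, hΞ, hΞ2⟩ := hL
  obtain ⟨x, y, hs, hsum, hx⟩ := hΞ2.exists_nuclear_series hΘ2
  obtain ⟨τ, hτ, hdiff, happrox⟩ := exists_entire_fredholmDet hs hsum (differentiable_expNeg A)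
  refine ⟨_, τ, L.isLyapunovSolution_expNeg_conj hA (L.lyapunov_of_operators hΘ hΞ hA),
    L.isTailIntegral_expNeg_conj hΘ hΞ hA,
    fun z => ⟨IsTraceClass.conj ⟨x, y, hs, hsum⟩ _, hτ z⟩, hdiff, ?_⟩
  obtain ⟨M, hM⟩ := L.exists_norm_expNeg_le hA
  -- A single N serves all t ≥ 0 with error below 1/2. At a large t the N × N determinant is also
  -- within 1/2 of 1, so τ t = 0 is impossible.
  obtain ⟨N, hN⟩ := (happrox M 2⁻¹ (by norm_num)).exists
  have hdecay : ∀ n k, Tendsto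
      (fun t : ℝ => inner ℂ (y n) (expNeg A t (expNeg A t (x k)))) atTop (𝓝 0) := by
    intro n k
    obtain ⟨f, hf⟩ := hx k
    -- Two exponentials act on x_k, so the weak decay is used at time t + t.
    have h1 := (hΞ.tendsto_inner_zero hA (y n) f).comp
      (tendsto_id.atTop_add_atTop (tendsto_id (α := ℝ)))
    refine h1.congr fun t => ?_
    simp [expNeg_add, hf]
  have hc : Continuous fun G : Fin N → Fin N → ℂ =>
      Matrix.det (1 + Matrix.of fun n m => G n m) :=
    continuous_det_one_add_of fun n m => by fun_prop
  have hlim := (hc.tendsto 0).comp (tendsto_pi_nhds.2 fun n : Fin N =>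
    tendsto_pi_nhds.2 fun k : Fin N => hdecay n k)
  have h1 : Matrix.det (1 + Matrix.of fun n m : Fin N => (0 : Fin N → Fin N → ℂ) n m) = 1 := by
    have : (Matrix.of fun n m : Fin N => (0 : Fin N → Fin N → ℂ) n m) = 0 := rfl
    rw [this, add_zero, Matrix.det_one]
  rw [h1] at hlim
  obtain ⟨t, ht, ht0⟩ := ((Metric.tendsto_nhds.1 hlim 2⁻¹ (by norm_num)).and
    (eventually_ge_atTop 0)).exists
  refine ⟨t, fun h0 => ?_⟩
  have h2 := hN t (hM t ht0)
  rw [h0, zero_sub, norm_neg] at h2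
  rw [dist_eq_norm, norm_sub_rev] at ht
  have h3 := norm_le_norm_add_norm_sub' (1 : ℂ)
    (Matrix.det (1 + Matrix.of fun n k : Fin N =>
      inner ℂ (y n) (expNeg A t (expNeg A t (x k)))))
  rw [norm_one] at h3
  simp only [Function.comp_apply] at ht
  linarith

theorem IsUniformlyContinuousPeriodicGroup.exists_tau {L : LinearSystem H H₀} {p : ℝ}
    (hp : 0 ≤ p) (hL : L.IsUniformlyContinuousPeriodicGroup p) {E : H →L[ℂ] H}
    (hE : IsTraceClass E) (hLE : AnticommutatorEq L.A E (L.B ∘L L.C)) :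
    ∃ (R : ℂ → H →L[ℂ] H) (τ : ℂ → ℂ),
      L.IsLyapunovSolution R ∧ R 0 = E ∧
      (∀ z, IsTraceClass (R z) ∧ HasFredholmDet (R z) (τ z)) ∧
      Differentiable ℂ τ ∧ ∀ z, τ (z + p) = τ z := by
  obtain ⟨U, hUS, hadd, hU, hper⟩ := hL
  obtain ⟨A, hA⟩ := L.exists_mem_graph_of_group hUS hadd hU
  obtain ⟨x, y, hs, hsum⟩ := id hE
  obtain ⟨τ, hτ, hdiff, -⟩ := exists_entire_fredholmDet hs hsum (differentiable_expNeg A)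
  -- Real periodicity gives e^{-pA} = U p = U 0 = 1, and the exponential law extends the period to
  -- complex z.
  have hperiod : ∀ z, expNeg A (z + p) = expNeg A z := by
    intro z
    rw [expNeg_add, ← L.S_eq_expNeg hA hp, ← hUS p hp, ← zero_add p, hper 0, hUS 0 le_rfl,
      L.S_zero, mul_one]
  refine ⟨_, τ, L.isLyapunovSolution_expNeg_conj hA
    ((anticommutatorEq_iff_of_mem_graph hA).1 hLE), by simp [expNeg_zero],
    fun z => ⟨hE.conj _, hτ z⟩, hdiff, fun z => ?_⟩
  refine HasFredholmDet.unique (hτ (z + p)) ?_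
  rw [hperiod]
  exact hτ z

end LinearSystem

end Admissible

end

theorem theorem1p1 {H : Type*} {H₀ : Type*}
    [NormedAddCommGroup H] [InnerProductSpace ℂ H] [CompleteSpace H]
    [NormedAddCommGroup H₀] [InnerProductSpace ℂ H₀] [CompleteSpace H₀] :
    (∀ L : LinearSystem H H₀, L.IsTwoTwoAdmissible → L.HasBoundedA →
      ∃ (R : ℂ → H →L[ℂ] H) (τ : ℂ → ℂ),
        L.IsLyapunovSolution R ∧ L.IsTailIntegral R ∧
        (∀ z, IsTraceClass (R z) ∧ HasFredholmDet (R z) (τ z)) ∧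
        Differentiable ℂ τ ∧ (∃ z, τ z ≠ 0) ∧ Meromorphic (potential τ)) ∧
    (∀ L : LinearSystem H H, L.IsUniformlyContinuousPeriodicGroup Real.pi →
      ∀ E : H →L[ℂ] H, IsTraceClass E → AnticommutatorEq L.A E (L.B ∘L L.C) →
      ∃ (R : ℂ → H →L[ℂ] H) (τ : ℂ → ℂ),
        L.IsLyapunovSolution R ∧ R 0 = E ∧
        (∀ z, IsTraceClass (R z) ∧ HasFredholmDet (R z) (τ z)) ∧
        Differentiable ℂ τ ∧ (∀ z, τ (z + Real.pi) = τ z) ∧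
        ((∃ z, τ z ≠ 0) → Meromorphic (potential τ))) := by
  refine ⟨fun L hL hb => ?_, fun L hL E hE hLE => ?_⟩
  · obtain ⟨A, hA⟩ := L.exists_mem_graph_of_hasBoundedA hb
    obtain ⟨R, τ, h1, h2, h3, h4, h5⟩ := hL.exists_tau hA
    exact ⟨R, τ, h1, h2, h3, h4, h5, meromorphic_potential h4⟩
  · obtain ⟨R, τ, h1, h2, h3, h4, h5⟩ := hL.exists_tau Real.pi_pos.le hE hLE
    exact ⟨R, τ, h1, h2, h3, h4, h5, fun _ => meromorphic_potential h4⟩
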